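/- \textbf{Theorem (Mercer's Theorem).} Let $a<b$ be real numbers and let $k:[a,b]\times[a,b]\to\mathbb{R}$ be a continuous, symmetric, positive semi-definite kernel (that is, $k(x,y)=k(y,x)$, and for all $n$ and all $x_1,\dots,x_n\in[a,b]$ the matrix $\big(k(x_i,x_j)\big)_{i,j=1}^n$ is positive semi-definite) which is bounded: $\sup_{x,y}k(x,y)<\infty$. For $f\in L_2(a,b)$ put $$T_kf(x):=\int_a^b k(x,y)\,f(y)\,dy ,\qquad x\in[a,b].$$ Then this integral exists for every $x\in[a,b]$, $T_k$ maps $L_2(a,b)$ into $L_2(a,b)$, and $T_k$ is positive semi-definite: $$\int_a^b\!\int_a^b k(x,y)\,f(x)\,f(y)\,dy\,dx\ \ge\ 0\qquad\text{for all } f\in L_2(a,b).$$ Moreover, there is an orthonormal basis $\{\psi_i\}_{i=1}^\infty$ of the real Hilbert space $L_2(a,b)$ consisting of eigenfunctions of $T_k$ with non-negative eigenvalues $\{\lambda_i\}_{i=1}^\infty$. With suitably chosen representatives $\psi_i:[a,b]\to\mathbb{R}$, $$\int_a^b k(x,y)\,\psi_i(y)\,dy=\lambda_i\,\psi_i(x)\qquad\text{for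 all } i \text{ and all } x\in[a,b],$$ the eigenfunctions $\psi_i$ with $\lambda_i\neq 0$ are continuous on $[a,b]$, and $$k(x,y)=\sum_{i=1}^\infty\lambda_i\,\psi_i(x)\,\psi_i(y)\qquad\text{for all } x,y\in[a,b],$$ where the series converges absolutely for all $x,y\in[a,b]$ and uniformly on $[a,b]\times[a,b]$. -/

import Mathlib

open MeasureTheory Set Filter

/-- A real function `k` of two variables is a Mercer kernel on the set `s`: it is symmetric on `s`,
and for every finite family of points of `s` its kernel (Gram) matrix `K i j = k (x i) (x j)` is
positive semi-definite. -/
structure IsMercerKernelOn {X : Type*} (k : X → X → ℝ) (s : Set X) : Prop where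
  symm : ∀ x ∈ s, ∀ y ∈ s, k x y = k y x
  posSemidef : ∀ (n : ℕ) (x : Fin n → X), (∀ i, x i ∈ s) →
    (Matrix.of fun i j : Fin n => k (x i) (x j)).PosSemidef

/-- Lebesgue measure on the open interval `(a, b)`. -/
noncomputable abbrev intervalMeasure (a b : ℝ) : Measure ℝ :=
  volume.restrict (Ioo a b)

/-- The real Hilbert space `L₂(a, b)`. -/
abbrev L2Interval (a b : ℝ) : Type :=
  Lp ℝ 2 (intervalMeasure a b)

/-- The integral operator with kernel `k`: `T_k f (x) = ∫_a^b k(x, y) f(y) dy`. -/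
noncomputable def integralOperator (a b : ℝ) (k : ℝ → ℝ → ℝ) (f : ℝ → ℝ) (x : ℝ) : ℝ :=
  ∫ y in a..b, k x y * f y

/-! Extend `k` to a bounded continuous kernel `K` on the plane by retracting onto `[a, b]`, and
write `T f x = ⟨K_x, f⟩` with `K_x = K (x, ·)` in `L₂`. The map `x ↦ K_x` is continuous, so the
`K_x` with `x ∈ [a, b]` form a compact set and `T` is a norm limit of finite rank operators. The
spectral theorem then gives an eigenbasis `e i`, with eigenvalues `λ i ≥ 0` because double integrals
are limits of finite quadratic forms.

For `λ i ≠ 0` the function `g i x = ⟨K_x, e i⟩ / √(λ i)` is a continuous version of `√(λ i) • e i`.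
The kernel `K - ∑ g i ⊗ g i` (finite sum) has a nonnegative quadratic form, hence a nonnegative
diagonal: `∑ g i x ^ 2 ≤ K (x, x)` (`sum_scaledEigenfunction_sq_le`). For fixed `x` this makes `∑ g
i x * g i y` uniformly convergent in `y`; its continuous sum agrees a.e. with the `L₂` expansion of
`K_x`, hence equals `K (x, y)` everywhere on the square (`hasSum_scaledEigenfunction_mul`). Dini's
theorem on the diagonal and the AM-GM bound `abs_sub_sum_mul_le` upgrade this to uniform convergence
on the square. -/

open scoped Topology BoundedContinuousFunction

/-! ### Hilbert space preliminaries -/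

section Hilbert

variable {E : Type*} [NormedAddCommGroup E] [InnerProductSpace ℝ E]

/-- An orthonormal family in a separable space is countable. -/
theorem Orthonormal.countable_of_separable [TopologicalSpace.SeparableSpace E] {ι : Type*}
    {v : ι → E} (hv : Orthonormal ℝ v) : Countable ι := by
  refine Pairwise.countable_of_isOpen_disjoint (s := fun i => Metric.ball (v i) (1 / 2)) ?_
    (fun i => Metric.isOpen_ball) (fun i => ⟨v i, Metric.mem_ball_self (by norm_num)⟩)
  intro i j hij
  refine Metric.ball_disjoint_ball ?_
  have h : dist (v i) (v j) ^ 2 = 2 := by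
    rw [dist_eq_norm, norm_sub_sq_real, hv.1 i, hv.1 j, hv.2 hij]
    norm_num
  nlinarith [dist_nonneg (x := v i) (y := v j)]

/-- A compact symmetric operator on a separable infinite dimensional Hilbert space admits a Hilbert
basis of eigenvectors. -/
theorem ContinuousLinearMap.exists_hilbertBasis_eigenvectors [CompleteSpace E]
    [TopologicalSpace.SeparableSpace E] (hE : ¬ FiniteDimensional ℝ E) {T : E →L[ℝ] E}
    (hT : IsCompactOperator T) (hT' : T.IsSymmetric) :
    ∃ (e : HilbertBasis ℕ ℝ E) (ev : ℕ → ℝ), ∀ i, T (e i) = ev i • e i := by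
  have hcl : ∀ μ : ℝ, IsClosed
      (Module.End.eigenspace (T : Module.End ℝ E) μ : Set E) := by
    intro μ
    have : (Module.End.eigenspace (T : Module.End ℝ E) μ : Set E) = {x | T x = μ • x} := by
      ext x
      simp
    rw [this]
    exact isClosed_eq T.continuous (continuous_const_smul μ)
  have hcomp : ∀ μ : ℝ, CompleteSpace
      (Module.End.eigenspace (T : Module.End ℝ E) μ) := fun μ =>
    (hcl μ).completeSpace_coe
  -- Every real `μ` is allowed: if it is not an eigenvalue, its eigenspace is zero and `w μ` is
  -- empty.
  choose w b hb using fun μ : ℝ =>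
    exists_hilbertBasis ℝ (Module.End.eigenspace (T : Module.End ℝ E) μ)
  let v : (Σ μ : ℝ, w μ) → E := fun a => (b a.1 a.2 : E)
  have hv : Orthonormal ℝ v :=
    hT'.orthogonalFamily_eigenspaces.orthonormal_sigma_orthonormal fun μ => (b μ).orthonormal
  have hspan : (Submodule.span ℝ (Set.range v))ᗮ = ⊥ := by
    rw [eq_bot_iff, ← ContinuousLinearMap.orthogonalComplement_iSup_eigenspaces_eq_bot hT hT']
    intro u hu
    rw [← Submodule.iInf_orthogonal, Submodule.mem_iInf]
    intro μ x hx
    have hx0 := (b μ).hasSum_repr ⟨x, hx⟩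
    have hx1 := hx0.mapL ((innerSL ℝ u).comp (Submodule.subtypeL _))
    have hx2 : ∀ i, ((innerSL ℝ u).comp (Submodule.subtypeL _)) ((b μ).repr ⟨x, hx⟩ i • b μ i)
        = 0 := by
      intro i
      have := (Submodule.mem_orthogonal _ u).1 hu (v ⟨μ, i⟩) (Submodule.subset_span ⟨_, rfl⟩)
      rw [real_inner_comm] at this
      simpa [v] using Or.inr this
    simp only [hx2] at hx1
    have := hx1.unique hasSum_zero
    rw [real_inner_comm]
    simpa using this
  have : Countable (Σ μ : ℝ, w μ) := hv.countable_of_separable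
  have : Infinite (Σ μ : ℝ, w μ) := by
    by_contra hfin
    rw [not_infinite_iff_finite] at hfin
    have := Fintype.ofFinite (Σ μ : ℝ, w μ)
    let B := (HilbertBasis.mkOfOrthogonalEqBot hv hspan).toOrthonormalBasis
    exact hE (Module.Basis.finiteDimensional_of_finite B.toBasis)
  obtain ⟨d⟩ := nonempty_denumerable (Σ μ : ℝ, w μ)
  let q := (Denumerable.eqv (Σ μ : ℝ, w μ)).symm
  have hspan' : (Submodule.span ℝ (Set.range (v ∘ q)))ᗮ = ⊥ := by
    rwa [q.surjective.range_comp]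
  refine ⟨HilbertBasis.mkOfOrthogonalEqBot (hv.comp q q.injective) hspan', fun i => (q i).1, ?_⟩
  intro i
  rw [HilbertBasis.coe_mkOfOrthogonalEqBot]
  exact Module.End.mem_eigenspace_iff.1 (b (q i).1 (q i).2).2

end Hilbert

/-- The Hilbert space `L₂(a, b)` is infinite dimensional. -/
theorem L2Interval_not_finiteDimensional {a b : ℝ} (hab : a < b) :
    ¬ FiniteDimensional ℝ (L2Interval a b) := by
  intro hfin
  have hmem : ∀ p : Polynomial ℝ, MemLp (fun x => p.eval x) 2 (intervalMeasure a b) := by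
    intro p
    obtain ⟨C, hC⟩ := isCompact_Icc.exists_bound_of_continuousOn (s := Icc a b)
      p.continuous.continuousOn
    refine MemLp.of_bound p.continuous.aestronglyMeasurable C ?_
    filter_upwards [ae_restrict_mem measurableSet_Ioo] with x hx using hC x (Ioo_subset_Icc_self hx)
  let F : Polynomial ℝ →ₗ[ℝ] L2Interval a b :=
    { toFun := fun p => (hmem p).toLp _
      map_add' := fun p q => by
        rw [← MemLp.toLp_add]
        simp only [Polynomial.eval_add]
        rfl
      map_smul' := fun c p => by
        rw [RingHom.id_apply, ← MemLp.toLp_const_smul]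
        simp only [Polynomial.eval_smul]
        rfl }
  -- A polynomial vanishing a.e. on `(a, b)` vanishes on all of it by continuity, so it has
  -- infinitely many roots.
  have hF : Function.Injective F := by
    rw [← LinearMap.ker_eq_bot, LinearMap.ker_eq_bot']
    intro p hp
    have h0 : (fun x => p.eval x) =ᵐ[intervalMeasure a b] fun _ => (0 : ℝ) := by
      have h1 := (hmem p).coeFn_toLp
      have h2 : (hmem p).toLp _ = 0 := hp
      rw [h2] at h1
      exact h1.symm.trans (Lp.coeFn_zero _ _ _)
    have h3 := Measure.eqOn_Ioo_of_ae_eq volume h0 p.continuous.continuousOn continuousOn_const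
    exact Polynomial.eq_zero_of_infinite_isRoot p ((Ioo_infinite hab).mono fun x hx => h3 hx)
  exact Polynomial.not_finite (Module.Finite.of_injective F hF)

/-! ### Integral operators with a bounded continuous kernel -/

section Kernel

variable (K : ℝ × ℝ →ᵇ ℝ) (μ : Measure ℝ) [IsFiniteMeasure μ]

theorem memLp_kernel_section (x : ℝ) : MemLp (fun y => K (x, y)) 2 μ :=
  MemLp.of_bound (by fun_prop) ‖K‖ (ae_of_all _ fun y => K.norm_coe_le_norm (x, y))

/-- The section `K (x, ·)` of a kernel as an element of `L₂(μ)`. -/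
noncomputable def kernelFeature (x : ℝ) : Lp ℝ 2 μ :=
  (memLp_kernel_section K μ x).toLp _

theorem coeFn_kernelFeature (x : ℝ) : kernelFeature K μ x =ᵐ[μ] fun y => K (x, y) :=
  MemLp.coeFn_toLp _

theorem inner_kernelFeature (x : ℝ) (f : Lp ℝ 2 μ) :
    inner ℝ (kernelFeature K μ x) f = ∫ y, K (x, y) * f y ∂μ := by
  rw [L2.inner_def]
  refine integral_congr_ae ?_
  filter_upwards [coeFn_kernelFeature K μ x] with y hy
  rw [hy]
  simp [mul_comm]

theorem continuous_kernelFeature : Continuous (kernelFeature K μ) := by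
  rw [continuous_iff_continuousAt]
  intro x
  rw [ContinuousAt, tendsto_iff_norm_sub_tendsto_zero]
  have hsq : ∀ z, ‖kernelFeature K μ z - kernelFeature K μ x‖ =
      √(∫ y, (K (z, y) - K (x, y)) ^ 2 ∂μ) := by
    intro z
    rw [norm_eq_sqrt_real_inner, L2.inner_def]
    congr 1
    refine integral_congr_ae ?_
    filter_upwards [Lp.coeFn_sub (kernelFeature K μ z) (kernelFeature K μ x),
      coeFn_kernelFeature K μ x, coeFn_kernelFeature K μ z] with y h1 h2 h3
    rw [h1, Pi.sub_apply, h2, h3]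
    simp [pow_two]
  simp only [hsq]
  have hc : Continuous fun z => ∫ y, (K (z, y) - K (x, y)) ^ 2 ∂μ := by
    refine continuous_of_dominated (bound := fun _ => (‖K‖ + ‖K‖) ^ 2) ?_ ?_ ?_ ?_
    · intro z
      exact Continuous.aestronglyMeasurable (by fun_prop)
    · intro z
      refine ae_of_all _ fun y => ?_
      rw [norm_pow]
      gcongr
      exact (norm_sub_le _ _).trans
        (add_le_add (K.norm_coe_le_norm _) (K.norm_coe_le_norm _))
    · exact integrable_const _
    · exact ae_of_all _ fun y => by fun_prop
  have := hc.sqrt.tendsto x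
  simpa using this

theorem norm_kernelFeature_le (x : ℝ) :
    ‖kernelFeature K μ x‖ ≤ measureUnivNNReal μ ^ (2 : ENNReal).toReal⁻¹ * ‖K‖ := by
  refine Lp.norm_le_of_ae_bound (norm_nonneg _) ?_
  filter_upwards [coeFn_kernelFeature K μ x] with y hy
  rw [hy]
  exact K.norm_coe_le_norm _

theorem memLp_inner_kernelFeature (f : Lp ℝ 2 μ) :
    MemLp (fun x => inner ℝ (kernelFeature K μ x) f) 2 μ := by
  have := continuous_kernelFeature K μ
  refine MemLp.of_bound (Continuous.aestronglyMeasurable (by fun_prop))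
    ((measureUnivNNReal μ ^ (2 : ENNReal).toReal⁻¹ * ‖K‖) * ‖f‖) (ae_of_all _ fun x => ?_)
  exact (norm_inner_le_norm _ _).trans
    (mul_le_mul_of_nonneg_right (norm_kernelFeature_le K μ x) (norm_nonneg _))

/-- The integral operator on `L₂(μ)` with kernel `K`. -/
noncomputable def kernelOperator : Lp ℝ 2 μ →L[ℝ] Lp ℝ 2 μ :=
  LinearMap.mkContinuous
    { toFun := fun f => (memLp_inner_kernelFeature K μ f).toLp _
      map_add' := fun f g => by
        rw [← MemLp.toLp_add]
        simp only [inner_add_right]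
        rfl
      map_smul' := fun c f => by
        rw [RingHom.id_apply, ← MemLp.toLp_const_smul]
        simp only [inner_smul_right]
        rfl }
    -- One factor `μ(univ)^(1/2)` bounds the norm of the features, the other turns the sup bound on
    -- the image into an `L₂` bound.
    (measureUnivNNReal μ ^ (2 : ENNReal).toReal⁻¹ *
      (measureUnivNNReal μ ^ (2 : ENNReal).toReal⁻¹ * ‖K‖)) (by
    intro f
    rw [mul_assoc]
    refine Lp.norm_le_of_ae_bound (by positivity) ?_
    filter_upwards [(memLp_inner_kernelFeature K μ f).coeFn_toLp] with x hx
    simp only [LinearMap.coe_mk, AddHom.coe_mk]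
    rw [hx]
    exact (norm_inner_le_norm _ _).trans
      (mul_le_mul_of_nonneg_right (norm_kernelFeature_le K μ x) (norm_nonneg _)))

theorem coeFn_kernelOperator (f : Lp ℝ 2 μ) :
    kernelOperator K μ f =ᵐ[μ] fun x => inner ℝ (kernelFeature K μ x) f :=
  (memLp_inner_kernelFeature K μ f).coeFn_toLp

/-- The features of points of `s` form a compact set, so they lie within `ε` of a finite-dimensional
`V`. With `P` the projection onto `V`, `(T P f - T f) x = ⟨P K_x - K_x, f⟩` is at most `ε ‖f‖`, so
`T` is a norm limit of the finite rank operators `T P`. -/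
theorem isCompactOperator_kernelOperator {s : Set ℝ} (hs : IsCompact s)
    (hμs : ∀ᵐ x ∂μ, x ∈ s) : IsCompactOperator (kernelOperator K μ) := by
  let T := kernelOperator K μ
  let C : ℝ := measureUnivNNReal μ ^ (2 : ENNReal).toReal⁻¹
  have hC : 0 ≤ C := by positivity
  have key : ∀ ε : ℝ, 0 < ε → ∃ S : Lp ℝ 2 μ →L[ℝ] Lp ℝ 2 μ,
      IsCompactOperator S ∧ ‖S - T‖ ≤ C * ε := by
    intro ε hε
    have hcpt : IsCompact (kernelFeature K μ '' s) := hs.image (continuous_kernelFeature K μ)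
    obtain ⟨t, -, ht, hcov⟩ := hcpt.finite_cover_balls hε
    let V := Submodule.span ℝ t
    have : FiniteDimensional ℝ V := FiniteDimensional.span_of_finite ℝ ht
    let P := V.starProjection
    refine ⟨T ∘L P, ?_, ?_⟩
    · have h1 : IsCompactOperator (T ∘L V.subtypeL) :=
        isCompactOperator_of_locallyCompactSpace_rng (T ∘L V.subtypeL)
      exact h1.comp_clm V.orthogonalProjectionOnto
    · refine ContinuousLinearMap.opNorm_le_bound _ (by positivity) fun f => ?_
      rw [mul_assoc]
      refine Lp.norm_le_of_ae_bound (by positivity) ?_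
      have h0 : (T ∘L P - T) f = T (P f - f) := by
        simp
      rw [h0]
      filter_upwards [coeFn_kernelOperator K μ (P f - f), hμs] with x hx hxs
      have hx' : (T (P f - f)) x = inner ℝ (kernelFeature K μ x) (P f - f) := hx
      rw [hx']
      have h1 : inner ℝ (kernelFeature K μ x) (P f - f) =
          inner ℝ (P (kernelFeature K μ x) - kernelFeature K μ x) f := by
        rw [inner_sub_right, inner_sub_left, Submodule.inner_starProjection_left_eq_right]
      rw [h1]
      refine (norm_inner_le_norm _ _).trans (mul_le_mul_of_nonneg_right ?_ (norm_nonneg _))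
      obtain ⟨u, hu, hxu⟩ := mem_iUnion₂.1 (hcov (mem_image_of_mem _ hxs))
      have huV : u ∈ V := Submodule.subset_span hu
      rw [norm_sub_rev, Submodule.starProjection_minimal]
      refine (ciInf_le ⟨0, ?_⟩ (⟨u, huV⟩ : V)).trans ?_
      · rintro _ ⟨y, rfl⟩
        exact norm_nonneg _
      · rw [← dist_eq_norm]
        exact (Metric.mem_ball.1 hxu).le
  choose S hS hST using fun n : ℕ => key (1 / ((n : ℝ) + 1)) (by positivity)
  refine isCompactOperator_of_tendsto (l := atTop) (F := S) ?_ (Eventually.of_forall hS)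
  rw [tendsto_iff_norm_sub_tendsto_zero]
  refine squeeze_zero (fun _ => norm_nonneg _) hST ?_
  simpa using tendsto_one_div_add_atTop_nhds_zero_nat.const_mul C

/-! ### Symmetry and positivity of the operator. -/

omit [IsFiniteMeasure μ] in
theorem integrable_kernel_mul {f g : ℝ → ℝ} (hf : Integrable f μ) (hg : Integrable g μ) :
    Integrable (fun p : ℝ × ℝ => K p * (f p.1 * g p.2)) (μ.prod μ) :=
  (hf.mul_prod hg).bdd_mul K.continuous.aestronglyMeasurable
    (ae_of_all _ fun p => K.norm_coe_le_norm p)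

theorem inner_kernelOperator (f g : Lp ℝ 2 μ) :
    inner ℝ f (kernelOperator K μ g) = ∫ p, K p * (f p.1 * g p.2) ∂μ.prod μ := by
  have hf : Integrable f μ := (Lp.memLp f).integrable (by norm_num)
  have hg : Integrable g μ := (Lp.memLp g).integrable (by norm_num)
  rw [integral_prod _ (integrable_kernel_mul K μ hf hg), L2.inner_def]
  refine integral_congr_ae ?_
  filter_upwards [coeFn_kernelOperator K μ g] with x hx
  rw [hx, inner_kernelFeature]
  simp only [RCLike.inner_apply, conj_trivial]
  rw [← integral_mul_const]
  congr 1 with y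
  ring

variable {K}

theorem kernelOperator_isSymmetric (hsymm : ∀ x y, K (x, y) = K (y, x)) :
    (kernelOperator K μ : Lp ℝ 2 μ →L[ℝ] Lp ℝ 2 μ).IsSymmetric := by
  intro f g
  change inner ℝ (kernelOperator K μ f) g = inner ℝ f (kernelOperator K μ g)
  rw [real_inner_comm, inner_kernelOperator, inner_kernelOperator, ← integral_prod_swap]
  congr 1 with p
  rw [Prod.swap, hsymm]
  ring

/-- The quadratic form of a positive semi-definite bounded continuous kernel is nonnegative on
integrable functions. -/
theorem integral_kernel_mul_nonneg
    (hpos : ∀ (s : Finset ℝ) (c : ℝ → ℝ), 0 ≤ ∑ u ∈ s, ∑ v ∈ s, K (u, v) * (c u * c v))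
    {f : ℝ → ℝ} (hf : Integrable f μ) :
    0 ≤ ∫ p, K p * (f p.1 * f p.2) ∂μ.prod μ := by
  -- Only the arguments of `K` are discretised, by simple functions tending to the identity; `f`
  -- stays untouched, so its integrability suffices for domination.
  let t : ℕ → SimpleFunc ℝ ℝ := fun n =>
    SimpleFunc.approxOn id measurable_id univ 0 (mem_univ _) n
  have ht : ∀ x, Tendsto (fun n => t n x) atTop (𝓝 x) := fun x =>
    SimpleFunc.tendsto_approxOn measurable_id (mem_univ _) (by simp)
  have hmeas : ∀ n, Measurable fun p : ℝ × ℝ => K (t n p.1, t n p.2) := fun n =>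
    K.continuous.measurable.comp
      (((t n).measurable.comp measurable_fst).prodMk ((t n).measurable.comp measurable_snd))
  have hlim : Tendsto (fun n => ∫ p, K (t n p.1, t n p.2) * (f p.1 * f p.2) ∂μ.prod μ) atTop
      (𝓝 (∫ p, K p * (f p.1 * f p.2) ∂μ.prod μ)) := by
    refine tendsto_integral_of_dominated_convergence
      (fun p => ‖K‖ * ‖f p.1 * f p.2‖) ?_ ?_ ?_ ?_
    · intro n
      exact (hmeas n).aestronglyMeasurable.mul (hf.mul_prod hf).aestronglyMeasurable
    · exact (hf.mul_prod hf).norm.const_mul _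
    · intro n
      refine ae_of_all _ fun p => ?_
      rw [norm_mul]
      exact mul_le_mul_of_nonneg_right (K.norm_coe_le_norm _) (norm_nonneg _)
    · refine ae_of_all _ fun p => ?_
      exact ((K.continuous.tendsto p).comp ((ht p.1).prodMk_nhds (ht p.2))).mul_const _
  refine ge_of_tendsto' hlim fun n => ?_
  -- Cutting `f` along the fibres of `t n` turns the integral into a finite quadratic form with
  -- coefficients `∫ A u`.
  let A : ℝ → ℝ → ℝ := fun u => (t n ⁻¹' {u}).indicator f
  have hA : ∀ u, Integrable (A u) μ := fun u => hf.indicator ((t n).measurableSet_fiber u)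
  have hsum : ∀ x, ∀ h : ℝ → ℝ, ∑ u ∈ (t n).range, h u * A u x = h (t n x) * f x := by
    intro x h
    rw [Finset.sum_eq_single_of_mem (t n x) ((t n).mem_range_self x)]
    · simp [A]
    · intro u _ hu
      simp [A, hu.symm]
  have hexp : ∀ p : ℝ × ℝ, K (t n p.1, t n p.2) * (f p.1 * f p.2) =
      ∑ u ∈ (t n).range, ∑ v ∈ (t n).range, K (u, v) * (A u p.1 * A v p.2) := by
    intro p
    have h1 : ∀ u, ∑ v ∈ (t n).range, K (u, v) * (A u p.1 * A v p.2) =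
        (K (u, t n p.2) * f p.2) * A u p.1 := by
      intro u
      rw [← hsum p.2 fun v => K (u, v), Finset.sum_mul]
      refine Finset.sum_congr rfl fun v _ => ?_
      ring
    simp only [h1]
    rw [hsum p.1 fun u => K (u, t n p.2) * f p.2]
    ring
  have hint : ∀ u v, Integrable (fun p : ℝ × ℝ => K (u, v) * (A u p.1 * A v p.2)) (μ.prod μ) :=
    fun u v => ((hA u).mul_prod (hA v)).const_mul _
  simp only [hexp]
  rw [integral_finsetSum _ fun u _ => integrable_finsetSum _ fun v _ => hint u v]
  have h2 : ∀ u ∈ (t n).range,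
      ∫ p : ℝ × ℝ, ∑ v ∈ (t n).range, K (u, v) * (A u p.1 * A v p.2) ∂μ.prod μ =
      ∑ v ∈ (t n).range, K (u, v) * ((∫ x, A u x ∂μ) * ∫ x, A v x ∂μ) := by
    intro u _
    rw [integral_finsetSum _ fun v _ => hint u v]
    refine Finset.sum_congr rfl fun v _ => ?_
    rw [integral_const_mul, integral_prod_mul]
  rw [Finset.sum_congr rfl h2]
  exact hpos _ fun u => ∫ x, A u x ∂μ

theorem kernelOperator_inner_nonneg
    (hpos : ∀ (s : Finset ℝ) (c : ℝ → ℝ), 0 ≤ ∑ u ∈ s, ∑ v ∈ s, K (u, v) * (c u * c v))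
    (f : Lp ℝ 2 μ) : 0 ≤ inner ℝ f (kernelOperator K μ f) := by
  rw [inner_kernelOperator]
  exact integral_kernel_mul_nonneg μ hpos ((Lp.memLp f).integrable (by norm_num))

end Kernel

/-! ### Sums of products of square summable sequences -/

/-- The tails of `∑ (u i ± v i) ^ 2` are nonnegative. -/
theorem abs_sub_sum_mul_le {u v : ℕ → ℝ} {A B C : ℝ} (hu : HasSum (fun i => u i ^ 2) A)
    (hv : HasSum (fun i => v i ^ 2) B) (huv : HasSum (fun i => u i * v i) C) (n : ℕ) :
    |C - ∑ i ∈ Finset.range n, u i * v i| ≤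
      ((A - ∑ i ∈ Finset.range n, u i ^ 2) + (B - ∑ i ∈ Finset.range n, v i ^ 2)) / 2 := by
  have h1 := sum_le_hasSum (Finset.range n) (fun i _ => by nlinarith [sq_nonneg (u i - v i)])
    ((hu.add hv).sub (huv.mul_left 2))
  have h2 := sum_le_hasSum (Finset.range n) (fun i _ => by nlinarith [sq_nonneg (u i + v i)])
    ((hu.add hv).add (huv.mul_left 2))
  simp only [Finset.sum_add_distrib, Finset.sum_sub_distrib, ← Finset.mul_sum] at h1 h2
  rw [abs_le]
  constructor <;> linarith

theorem summable_abs_mul_of_sq {u v : ℕ → ℝ} (hu : Summable fun i => u i ^ 2)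
    (hv : Summable fun i => v i ^ 2) : Summable fun i => |u i * v i| := by
  refine Summable.of_nonneg_of_le (fun _ => abs_nonneg _) (fun i => ?_) (hu.add hv)
  rw [abs_le]
  constructor <;> nlinarith [sq_nonneg (u i + v i), sq_nonneg (u i - v i)]

/-- Apply the tail bound to `u i / r` and `r * g i y`: a small `r` absorbs the bound `M`, which need
not come with uniformly small tails, and then the tail of `∑ u i ^ 2` absorbs `1 / r ^ 2`. -/
theorem tendstoUniformlyOn_sum_mul {X : Type*} {s : Set X} {u : ℕ → ℝ}
    {g : ℕ → X → ℝ} {M : ℝ} (hu : Summable fun i => u i ^ 2)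
    (hM : ∀ y ∈ s, ∀ n, ∑ i ∈ Finset.range n, g i y ^ 2 ≤ M) :
    TendstoUniformlyOn (fun n y => ∑ i ∈ Finset.range n, u i * g i y)
      (fun y => ∑' i, u i * g i y) atTop s := by
  have hg : ∀ y ∈ s, Summable fun i => g i y ^ 2 := fun y hy =>
    summable_of_sum_range_le (fun _ => sq_nonneg _) (hM y hy)
  rw [Metric.tendstoUniformlyOn_iff]
  intro ε hε
  obtain ⟨r, hr, hrM⟩ : ∃ r : ℝ, 0 < r ∧ r ^ 2 * M < ε := by
    have hc : Tendsto (fun r : ℝ => r ^ 2 * M) (𝓝[>] 0) (𝓝 0) := by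
      have : Continuous fun r : ℝ => r ^ 2 * M := by fun_prop
      simpa using (this.tendsto 0).mono_left nhdsWithin_le_nhds
    obtain ⟨r, hr1, hr2⟩ := ((hc.eventually_lt_const hε).and self_mem_nhdsWithin).exists
    exact ⟨r, hr2, hr1⟩
  have hlim := (hu.hasSum.tendsto_sum_nat.const_sub (∑' i, u i ^ 2)).div_const (r ^ 2)
  simp only [sub_self, zero_div] at hlim
  filter_upwards [hlim.eventually_lt_const hε] with n hn y hy
  rw [Real.dist_eq]
  have h1 : HasSum (fun i => (u i / r) ^ 2) ((∑' i, u i ^ 2) / r ^ 2) := by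
    simpa only [div_pow] using hu.hasSum.div_const (r ^ 2)
  have h2 : HasSum (fun i => (r * g i y) ^ 2) (r ^ 2 * ∑' i, g i y ^ 2) := by
    simpa only [mul_pow] using (hg y hy).hasSum.mul_left (r ^ 2)
  have h3 : ∀ i, u i / r * (r * g i y) = u i * g i y := fun i => by field_simp
  have h4 := (summable_abs_mul_of_sq hu (hg y hy)).of_abs.hasSum
  have h5 := abs_sub_sum_mul_le h1 h2 (by simpa only [h3] using h4) n
  simp only [h3, div_pow, mul_pow, ← Finset.sum_div, ← Finset.mul_sum] at h5
  have h6 : ∑' i, g i y ^ 2 ≤ M := Real.tsum_le_of_sum_range_le (fun _ => sq_nonneg _) (hM y hy)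
  have h7 : 0 ≤ ∑ i ∈ Finset.range n, g i y ^ 2 := Finset.sum_nonneg fun _ _ => sq_nonneg _
  have h8 : r ^ 2 * ∑' i, g i y ^ 2 ≤ r ^ 2 * M := by gcongr
  have h9 : 0 ≤ r ^ 2 * ∑ i ∈ Finset.range n, g i y ^ 2 := by positivity
  rw [sub_div] at hn
  linarith

/-! ### Diagonal values -/

/-- A continuous function whose integrals over all squares `U ×ˢ U` are nonnegative is nonnegative
on the diagonal. -/
theorem diag_nonneg_of_setIntegral_nonneg {a b : ℝ} (hab : a < b) {G : ℝ × ℝ → ℝ}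
    (hG : Continuous G)
    (h : ∀ U, MeasurableSet U →
      0 ≤ ∫ p in U ×ˢ U, G p ∂(intervalMeasure a b).prod (intervalMeasure a b))
    {x : ℝ} (hx : x ∈ Icc a b) : 0 ≤ G (x, x) := by
  by_contra! hneg
  have hev : ∀ᶠ p in 𝓝 (x, x), G p < G (x, x) / 2 :=
    (hG.tendsto (x, x)).eventually_lt_const (by linarith)
  obtain ⟨δ, hδ, hball⟩ := Metric.eventually_nhds_iff_ball.1 hev
  -- `U` has positive measure even when `x` is an endpoint, and `G ≤ G (x, x) / 2 < 0` on `U ×ˢ U`,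
  -- so the integral there would be negative.
  let U := Metric.ball x δ ∩ Ioo a b
  have hU : MeasurableSet U := Metric.isOpen_ball.measurableSet.inter measurableSet_Ioo
  have hUpos : 0 < (intervalMeasure a b).real U := by
    rw [measureReal_def, ENNReal.toReal_pos_iff]
    refine ⟨?_, measure_lt_top _ _⟩
    rw [Measure.restrict_apply hU, inter_assoc, inter_self]
    refine (Metric.isOpen_ball.inter isOpen_Ioo).measure_pos _ ?_
    rw [← closure_Ioo hab.ne] at hx
    obtain ⟨y, hy, hyx⟩ := Metric.mem_closure_iff.1 hx δ hδ
    exact ⟨y, by rwa [Metric.mem_ball, dist_comm], hy⟩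
  have hUG : ∀ p ∈ U ×ˢ U, G p ≤ G (x, x) / 2 := by
    intro p hp
    refine (hball p ?_).le
    rw [← ball_prod_same]
    exact ⟨hp.1.1, hp.2.1⟩
  have hint : IntegrableOn G (U ×ˢ U) ((intervalMeasure a b).prod (intervalMeasure a b)) := by
    obtain ⟨C, hC⟩ := (isCompact_Icc (a := a) (b := b)).prod (isCompact_Icc (a := a) (b := b))
      |>.exists_bound_of_continuousOn hG.continuousOn
    refine Integrable.of_bound hG.aestronglyMeasurable C ?_
    filter_upwards [ae_restrict_mem (hU.prod hU)] with p hp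
    exact hC p ⟨Ioo_subset_Icc_self hp.1.2, Ioo_subset_Icc_self hp.2.2⟩
  have h1 := setIntegral_mono_on hint (integrable_const (G (x, x) / 2)) (hU.prod hU) hUG
  have h2 := h U hU
  rw [setIntegral_const, measureReal_prod_prod, smul_eq_mul] at h1
  nlinarith [mul_pos hUpos hUpos]

/-! ### The eigenfunction expansion -/

section Expansion

variable {a b : ℝ} {K : ℝ × ℝ →ᵇ ℝ} {e : HilbertBasis ℕ ℝ (L2Interval a b)} {ev : ℕ → ℝ}

variable (K e ev) in
/-- The continuous representative of the eigenfunction `e i`, scaled by the square root of its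
eigenvalue; it vanishes if the eigenvalue does. -/
noncomputable def scaledEigenfunction (i : ℕ) (x : ℝ) : ℝ :=
  inner ℝ (kernelFeature K (intervalMeasure a b) x) (e i) / √(ev i)

theorem continuous_scaledEigenfunction (i : ℕ) : Continuous (scaledEigenfunction K e ev i) := by
  have := continuous_kernelFeature K (intervalMeasure a b)
  unfold scaledEigenfunction
  fun_prop

theorem eigenvalue_nonneg
    (hpos : ∀ (s : Finset ℝ) (c : ℝ → ℝ), 0 ≤ ∑ u ∈ s, ∑ v ∈ s, K (u, v) * (c u * c v))
    (he : ∀ i, kernelOperator K (intervalMeasure a b) (e i) = ev i • e i) (i : ℕ) :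
    0 ≤ ev i := by
  have := kernelOperator_inner_nonneg (intervalMeasure a b) hpos (e i)
  rw [he, inner_smul_right, real_inner_self_eq_norm_sq, e.orthonormal.1 i] at this
  simpa using this

theorem inner_kernelFeature_ae_eq
    (he : ∀ i, kernelOperator K (intervalMeasure a b) (e i) = ev i • e i) (i : ℕ) :
    (fun x => inner ℝ (kernelFeature K (intervalMeasure a b) x) (e i))
      =ᵐ[intervalMeasure a b] fun x => ev i * e i x := by
  have h1 := coeFn_kernelOperator K (intervalMeasure a b) (e i)
  rw [he] at h1
  filter_upwards [h1, Lp.coeFn_smul (ev i) (e i)] with x hx hx'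
  rw [← hx, hx', Pi.smul_apply, smul_eq_mul]

theorem eqOn_Icc_of_ae_eq_intervalMeasure (hab : a < b) {f g : ℝ → ℝ}
    (h : f =ᵐ[intervalMeasure a b] g) (hf : ContinuousOn f (Icc a b))
    (hg : ContinuousOn g (Icc a b)) : EqOn f g (Icc a b) := by
  refine Measure.eqOn_Icc_of_ae_eq volume hab.ne ?_ hf hg
  rwa [intervalMeasure, Measure.restrict_congr_set Ioo_ae_eq_Icc] at h

/-- The left side is continuous in `x` and a.e. equal to `0 * e i x`. Hence eigenfunctions for the
eigenvalue `0` satisfy the eigenvalue equation at every point, whatever their representative. -/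
theorem inner_kernelFeature_eq_zero (hab : a < b)
    (he : ∀ i, kernelOperator K (intervalMeasure a b) (e i) = ev i • e i) {i : ℕ}
    (hi : ev i = 0) {x : ℝ} (hx : x ∈ Icc a b) :
    inner ℝ (kernelFeature K (intervalMeasure a b) x) (e i) = 0 := by
  have h1 := inner_kernelFeature_ae_eq he i
  simp only [hi, zero_mul] at h1
  have := continuous_kernelFeature K (intervalMeasure a b)
  exact eqOn_Icc_of_ae_eq_intervalMeasure hab h1 (by fun_prop) continuousOn_const hx

theorem scaledEigenfunction_ae_eq
    (he : ∀ i, kernelOperator K (intervalMeasure a b) (e i) = ev i • e i) (i : ℕ) :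
    scaledEigenfunction K e ev i =ᵐ[intervalMeasure a b] fun x => √(ev i) * e i x := by
  filter_upwards [inner_kernelFeature_ae_eq he i] with x hx
  rw [scaledEigenfunction, hx, mul_div_right_comm, Real.div_sqrt]

theorem sqrt_mul_scaledEigenfunction (hab : a < b)
    (hpos : ∀ (s : Finset ℝ) (c : ℝ → ℝ), 0 ≤ ∑ u ∈ s, ∑ v ∈ s, K (u, v) * (c u * c v))
    (he : ∀ i, kernelOperator K (intervalMeasure a b) (e i) = ev i • e i) (i : ℕ)
    {x : ℝ} (hx : x ∈ Icc a b) :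
    √(ev i) * scaledEigenfunction K e ev i x =
      inner ℝ (kernelFeature K (intervalMeasure a b) x) (e i) := by
  rcases (eigenvalue_nonneg hpos he i).eq_or_lt with h | h
  · simp [← h, inner_kernelFeature_eq_zero hab he h.symm hx]
  · have := Real.sqrt_pos.2 h
    rw [scaledEigenfunction]
    field_simp

/-- Parseval for `f` and `T f`, with `T` moved onto `e i` by symmetry. -/
theorem hasSum_inner_kernelOperator (hsymm : ∀ x y, K (x, y) = K (y, x))
    (he : ∀ i, kernelOperator K (intervalMeasure a b) (e i) = ev i • e i)
    (f : L2Interval a b) :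
    HasSum (fun i => ev i * inner ℝ f (e i) ^ 2)
      (inner ℝ f (kernelOperator K (intervalMeasure a b) f)) := by
  have h := e.hasSum_inner_mul_inner f (kernelOperator K (intervalMeasure a b) f)
  suffices hfun : (fun i => ev i * inner ℝ f (e i) ^ 2) = fun i =>
      inner ℝ f (e i) * inner ℝ (e i) (kernelOperator K (intervalMeasure a b) f) by
    rwa [hfun]
  funext i
  have h1 : inner ℝ (kernelOperator K (intervalMeasure a b) (e i)) f =
      inner ℝ (e i) (kernelOperator K (intervalMeasure a b) f) :=
    kernelOperator_isSymmetric (intervalMeasure a b) hsymm (e i) f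
  rw [← h1, he, inner_smul_left, real_inner_comm (e i) f]
  simp only [conj_trivial]
  ring

/-- Tested on the indicator `f` of `U`, the kernel minus its partial sum gives the tail of `∑ ev i *
⟨f, e i⟩ ^ 2`, which is nonnegative; `diag_nonneg_of_setIntegral_nonneg` passes to the diagonal. -/
theorem sum_scaledEigenfunction_sq_le (hab : a < b) (hsymm : ∀ x y, K (x, y) = K (y, x))
    (hpos : ∀ (s : Finset ℝ) (c : ℝ → ℝ), 0 ≤ ∑ u ∈ s, ∑ v ∈ s, K (u, v) * (c u * c v))
    (he : ∀ i, kernelOperator K (intervalMeasure a b) (e i) = ev i • e i)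
    {x : ℝ} (hx : x ∈ Icc a b) (n : ℕ) :
    ∑ i ∈ Finset.range n, scaledEigenfunction K e ev i x ^ 2 ≤ K (x, x) := by
  set μ := intervalMeasure a b with hμ
  let g := scaledEigenfunction K e ev
  have hgc : ∀ i, Continuous (g i) := continuous_scaledEigenfunction
  suffices h : 0 ≤ K (x, x) - ∑ i ∈ Finset.range n, g i x * g i x by
    simp only [pow_two]
    exact sub_nonneg.1 h
  refine diag_nonneg_of_setIntegral_nonneg (a := a) (b := b) hab
    (G := fun p => K p - ∑ i ∈ Finset.range n, g i p.1 * g i p.2) (by fun_prop) ?_ hx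
  intro U hU
  rw [← hμ]
  have hgint : ∀ i, Integrable (g i) μ := by
    intro i
    refine (((Lp.memLp (e i)).integrable (by norm_num)).const_mul (√(ev i))).congr ?_
    exact (scaledEigenfunction_ae_eq he i).symm
  have hggint : ∀ i, IntegrableOn (fun p : ℝ × ℝ => g i p.1 * g i p.2) (U ×ˢ U) (μ.prod μ) :=
    fun i => ((hgint i).mul_prod (hgint i)).integrableOn
  have hKint : IntegrableOn K (U ×ˢ U) (μ.prod μ) :=
    Integrable.of_bound K.continuous.aestronglyMeasurable ‖K‖
      (ae_of_all _ fun p => K.norm_coe_le_norm p)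
  rw [integral_sub hKint (integrable_finsetSum _ fun i _ => hggint i),
    integral_finsetSum _ fun i _ => hggint i]
  let f : Lp ℝ 2 μ := indicatorConstLp 2 hU (measure_ne_top μ U) (1 : ℝ)
  have hf : f =ᵐ[μ] U.indicator fun _ => (1 : ℝ) := indicatorConstLp_coeFn
  have hK : ∫ p in U ×ˢ U, K p ∂μ.prod μ = inner ℝ f (kernelOperator K μ f) := by
    rw [inner_kernelOperator, ← integral_indicator (hU.prod hU)]
    refine integral_congr_ae ?_
    filter_upwards [Measure.quasiMeasurePreserving_fst.ae_eq_comp hf,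
      Measure.quasiMeasurePreserving_snd.ae_eq_comp hf] with p h1 h2
    simp only [Function.comp_apply] at h1 h2
    rw [h1, h2]
    by_cases hp1 : p.1 ∈ U <;> by_cases hp2 : p.2 ∈ U <;> simp [indicator, hp1, hp2]
  have hg : ∀ i, ∫ p in U ×ˢ U, g i p.1 * g i p.2 ∂μ.prod μ = ev i * inner ℝ f (e i) ^ 2 := by
    intro i
    rw [setIntegral_prod_mul]
    have h1 : ∫ x in U, g i x ∂μ = √(ev i) * inner ℝ f (e i) := by
      rw [L2.inner_indicatorConstLp_one, ← integral_const_mul]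
      exact integral_congr_ae (ae_restrict_of_ae (scaledEigenfunction_ae_eq he i))
    rw [h1]
    linear_combination (inner ℝ f (e i)) ^ 2 * Real.mul_self_sqrt (eigenvalue_nonneg hpos he i)
  rw [hK, sub_nonneg, Finset.sum_congr rfl fun i _ => hg i]
  refine sum_le_hasSum _ (fun i _ => ?_) (hasSum_inner_kernelOperator hsymm he f)
  exact mul_nonneg (eigenvalue_nonneg hpos he i) (sq_nonneg _)

theorem summable_scaledEigenfunction_sq (hab : a < b) (hsymm : ∀ x y, K (x, y) = K (y, x))
    (hpos : ∀ (s : Finset ℝ) (c : ℝ → ℝ), 0 ≤ ∑ u ∈ s, ∑ v ∈ s, K (u, v) * (c u * c v))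
    (he : ∀ i, kernelOperator K (intervalMeasure a b) (e i) = ev i • e i)
    {x : ℝ} (hx : x ∈ Icc a b) :
    Summable fun i => scaledEigenfunction K e ev i x ^ 2 :=
  summable_of_sum_range_le (fun _ => sq_nonneg _)
    (sum_scaledEigenfunction_sq_le hab hsymm hpos he hx)

/-- The pointwise expansion of the kernel. -/
theorem hasSum_scaledEigenfunction_mul (hab : a < b) (hsymm : ∀ x y, K (x, y) = K (y, x))
    (hpos : ∀ (s : Finset ℝ) (c : ℝ → ℝ), 0 ≤ ∑ u ∈ s, ∑ v ∈ s, K (u, v) * (c u * c v))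
    (he : ∀ i, kernelOperator K (intervalMeasure a b) (e i) = ev i • e i)
    {x y : ℝ} (hx : x ∈ Icc a b) (hy : y ∈ Icc a b) :
    HasSum (fun i => scaledEigenfunction K e ev i x * scaledEigenfunction K e ev i y)
      (K (x, y)) := by
  set μ := intervalMeasure a b with hμ
  let g := scaledEigenfunction K e ev
  have hgc : ∀ i, Continuous (g i) := continuous_scaledEigenfunction
  have hsq : ∀ z ∈ Icc a b, Summable fun i => g i z ^ 2 := fun z hz =>
    summable_scaledEigenfunction_sq hab hsymm hpos he hz
  have hunif := tendstoUniformlyOn_sum_mul (s := Icc a b) (u := fun i => g i x) (g := g)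
    (M := ‖K‖) (hsq x hx) fun z hz n =>
      (sum_scaledEigenfunction_sq_le hab hsymm hpos he hz n).trans
        ((le_abs_self _).trans (K.norm_coe_le_norm _))
  have hcont : ContinuousOn (fun z => ∑' i, g i x * g i z) (Icc a b) :=
    hunif.continuousOn (Frequently.of_forall fun n => by fun_prop)
  -- The coefficients are `√(ev i) * g i x`, so these `L₂` partial sums are a.e. the uniformly
  -- convergent ones; an a.e. convergent subsequence identifies the two limits.
  have hL2 := (e.hasSum_repr (kernelFeature K μ x)).tendsto_sum_nat
  obtain ⟨ns, hns, hae⟩ := (tendstoInMeasure_of_tendsto_Lp hL2).exists_seq_tendsto_ae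
  have hpart : ∀ n, ⇑(∑ i ∈ Finset.range n, e.repr (kernelFeature K μ x) i • e i)
      =ᵐ[μ] fun z => ∑ i ∈ Finset.range n, g i x * g i z := by
    intro n
    have h1 : ∀ i, ⇑(e.repr (kernelFeature K μ x) i • e i) =ᵐ[μ] fun z => g i x * g i z := by
      intro i
      filter_upwards [Lp.coeFn_smul (e.repr (kernelFeature K μ x) i) (e i),
        scaledEigenfunction_ae_eq he i] with z h2 h3
      rw [h2, Pi.smul_apply, smul_eq_mul, e.repr_apply_apply, real_inner_comm,
        ← sqrt_mul_scaledEigenfunction hab hpos he i hx]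
      simp only [g]
      rw [h3]
      ring
    have h2 := Lp.coeFn_finsetSum (Finset.range n)
      (fun i => e.repr (kernelFeature K μ x) i • e i)
    filter_upwards [h2, ae_all_iff.2 h1] with z h3 h4
    rw [h3, Finset.sum_apply]
    exact Finset.sum_congr rfl fun i _ => h4 i
  have haeq : (fun z => ∑' i, g i x * g i z) =ᵐ[μ] fun z => K (x, z) := by
    filter_upwards [hae, ae_all_iff.2 hpart, coeFn_kernelFeature K μ x,
      ae_restrict_mem measurableSet_Ioo] with z h1 h2 h3 h4
    rw [← h3]
    simp only [h2] at h1
    exact tendsto_nhds_unique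
      ((hunif.tendsto_at (Ioo_subset_Icc_self h4)).comp hns.tendsto_atTop) h1
  have heq := eqOn_Icc_of_ae_eq_intervalMeasure hab haeq hcont (by fun_prop) hy
  simp only at heq
  rw [← heq]
  exact (summable_abs_mul_of_sq (hsq x hx) (hsq y hy)).of_abs.hasSum

/-- The expansion of the kernel converges uniformly. -/
theorem tendstoUniformlyOn_scaledEigenfunction_mul (hab : a < b)
    (hsymm : ∀ x y, K (x, y) = K (y, x))
    (hpos : ∀ (s : Finset ℝ) (c : ℝ → ℝ), 0 ≤ ∑ u ∈ s, ∑ v ∈ s, K (u, v) * (c u * c v))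
    (he : ∀ i, kernelOperator K (intervalMeasure a b) (e i) = ev i • e i) :
    TendstoUniformlyOn
      (fun n (p : ℝ × ℝ) => ∑ i ∈ Finset.range n,
        scaledEigenfunction K e ev i p.1 * scaledEigenfunction K e ev i p.2)
      K atTop (Icc a b ×ˢ Icc a b) := by
  let g := scaledEigenfunction K e ev
  have hgc : ∀ i, Continuous (g i) := continuous_scaledEigenfunction
  have hdiag : ∀ x ∈ Icc a b, HasSum (fun i => g i x ^ 2) (K (x, x)) := fun x hx => by
    simpa only [pow_two] using hasSum_scaledEigenfunction_mul hab hsymm hpos he hx hx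
  -- Dini applies on the diagonal, where the terms are nonnegative and the limit `K (x, x)` is
  -- already known to be continuous.
  have hdini : TendstoUniformlyOn (fun n x => ∑ i ∈ Finset.range n, g i x ^ 2)
      (fun x => K (x, x)) atTop (Icc a b) := by
    refine Monotone.tendstoUniformlyOn_of_forall_tendsto isCompact_Icc
      (fun n => by fun_prop) (fun x _ => ?_) (by fun_prop) fun x hx => (hdiag x hx).tendsto_sum_nat
    exact monotone_nat_of_le_succ fun n => by
      rw [Finset.sum_range_succ]
      exact le_add_of_nonneg_right (sq_nonneg _)
  rw [Metric.tendstoUniformlyOn_iff] at hdini ⊢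
  intro ε hε
  filter_upwards [hdini ε hε] with n hn p hp
  have h1 := (le_abs_self _).trans_lt (hn p.1 hp.1)
  have h2 := (le_abs_self _).trans_lt (hn p.2 hp.2)
  -- The tail at `(x, y)` is at most the mean of the diagonal tails at `x` and `y`.
  have h3 := abs_sub_sum_mul_le (hdiag p.1 hp.1) (hdiag p.2 hp.2)
    (hasSum_scaledEigenfunction_mul hab hsymm hpos he hp.1 hp.2) n
  rw [Real.dist_eq]
  linarith

end Expansion

/-! ### Mercer's theorem -/

/-- A kernel which is continuous on a square is the restriction of a bounded continuous kernel
on the plane, with values among those on the square. -/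
theorem exists_boundedContinuous_extension_kernel {a b : ℝ} (hab : a ≤ b) {k : ℝ → ℝ → ℝ}
    (hcont : ContinuousOn (fun p : ℝ × ℝ => k p.1 p.2) (Icc a b ×ˢ Icc a b)) :
    ∃ (K : ℝ × ℝ →ᵇ ℝ) (r : ℝ → ℝ), (∀ x, r x ∈ Icc a b) ∧ (∀ x ∈ Icc a b, r x = x) ∧
      ∀ x y, K (x, y) = k (r x) (r y) := by
  let r : ℝ → ℝ := fun x => projIcc a b hab x
  have hr : ∀ x, r x ∈ Icc a b := fun x => (projIcc a b hab x).2
  have hrc : Continuous r := continuous_subtype_val.comp continuous_projIcc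
  obtain ⟨C, hC⟩ := ((isCompact_Icc (a := a) (b := b)).prod
    (isCompact_Icc (a := a) (b := b))).exists_bound_of_continuousOn hcont
  have hKc : Continuous fun p : ℝ × ℝ => k (r p.1) (r p.2) :=
    hcont.comp_continuous (f := fun p : ℝ × ℝ => (r p.1, r p.2)) (by fun_prop)
      fun p => ⟨hr p.1, hr p.2⟩
  refine ⟨BoundedContinuousFunction.ofNormedAddCommGroup _ hKc C
    fun p => hC (r p.1, r p.2) ⟨hr p.1, hr p.2⟩, r, hr, fun x hx => ?_, fun x y => rfl⟩
  simp [r, projIcc_of_mem hab hx]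

/-- The points `r u` may coincide, as they do for a retraction; the Gram matrix condition does not
ask for distinct points. -/
theorem IsMercerKernelOn.sum_nonneg {X ι : Type*} {k : X → X → ℝ} {s : Set X}
    (hk : IsMercerKernelOn k s) (r : ι → X) (hr : ∀ i, r i ∈ s) (t : Finset ι) (c : ι → ℝ) :
    0 ≤ ∑ u ∈ t, ∑ v ∈ t, k (r u) (r v) * (c u * c v) := by
  let q := t.equivFin.symm
  have h := (hk.posSemidef t.card (fun i => r (q i)) fun i => hr _).dotProduct_mulVec_nonneg
    fun i => c (q i)
  simp only [dotProduct, Matrix.mulVec, Matrix.of_apply, Pi.star_apply, star_trivial] at h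
  rw [q.sum_comp fun u : t => c u * ∑ j, k (r u) (r (q j)) * c (q j)] at h
  have h1 : ∀ u : t, ∑ j, k (r u) (r (q j)) * c (q j) = ∑ v ∈ t, k (r u) (r v) * c v := by
    intro u
    rw [q.sum_comp fun v : t => k (r u) (r v) * c v,
      Finset.sum_coe_sort t fun v => k (r u) (r v) * c v]
  simp only [h1] at h
  rw [Finset.sum_coe_sort t fun u => c u * ∑ v ∈ t, k (r u) (r v) * c v] at h
  refine h.trans_eq (Finset.sum_congr rfl fun u _ => ?_)
  rw [Finset.mul_sum]
  exact Finset.sum_congr rfl fun v _ => by ring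

theorem intervalIntegral_eq_integral_intervalMeasure {a b : ℝ} (hab : a ≤ b) (f : ℝ → ℝ) :
    ∫ x in a..b, f x = ∫ x, f x ∂intervalMeasure a b := by
  rw [intervalIntegral.integral_of_le hab, integral_Ioc_eq_integral_Ioo]

/-! ### Transfer from the extended kernel `K` back to `k` on the interval. -/

section Restriction

variable {a b : ℝ} {k : ℝ → ℝ → ℝ} {K : ℝ × ℝ →ᵇ ℝ}

theorem integralOperator_eq_inner (hab : a ≤ b)
    (hkK : ∀ x ∈ Icc a b, ∀ y ∈ Icc a b, K (x, y) = k x y) {f : ℝ → ℝ}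
    {F : L2Interval a b} (hF : F =ᵐ[intervalMeasure a b] f) {x : ℝ} (hx : x ∈ Icc a b) :
    integralOperator a b k f x =
      inner ℝ (kernelFeature K (intervalMeasure a b) x) F := by
  rw [integralOperator, intervalIntegral_eq_integral_intervalMeasure hab, inner_kernelFeature]
  refine integral_congr_ae ?_
  filter_upwards [hF, ae_restrict_mem measurableSet_Ioo] with y h1 h2
  rw [h1, hkK x hx y (Ioo_subset_Icc_self h2)]

theorem intervalIntegrable_kernel_mul (hab : a ≤ b)
    (hkK : ∀ x ∈ Icc a b, ∀ y ∈ Icc a b, K (x, y) = k x y) {f : ℝ → ℝ}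
    (hf : MemLp f 2 (intervalMeasure a b)) {x : ℝ} (hx : x ∈ Icc a b) :
    IntervalIntegrable (fun y => k x y * f y) volume a b := by
  rw [intervalIntegrable_iff_integrableOn_Ioo_of_le hab]
  have h1 : Integrable (fun y => K (x, y) * f y) (intervalMeasure a b) :=
    (hf.integrable (by norm_num)).bdd_mul (by fun_prop)
      (ae_of_all _ fun y => K.norm_coe_le_norm (x, y))
  refine Integrable.congr h1 ?_
  filter_upwards [ae_restrict_mem measurableSet_Ioo] with y hy
  rw [hkK x hx y (Ioo_subset_Icc_self hy)]

theorem memLp_integralOperator (hab : a ≤ b)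
    (hkK : ∀ x ∈ Icc a b, ∀ y ∈ Icc a b, K (x, y) = k x y) {f : ℝ → ℝ}
    (hf : MemLp f 2 (intervalMeasure a b)) :
    MemLp (integralOperator a b k f) 2 (intervalMeasure a b) := by
  refine (memLp_inner_kernelFeature K (intervalMeasure a b) (hf.toLp f)).ae_eq ?_
  filter_upwards [ae_restrict_mem measurableSet_Ioo] with x hx
  rw [integralOperator_eq_inner hab hkK hf.coeFn_toLp (Ioo_subset_Icc_self hx)]

theorem intervalIntegral_kernel_mul_nonneg (hab : a ≤ b)
    (hkK : ∀ x ∈ Icc a b, ∀ y ∈ Icc a b, K (x, y) = k x y)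
    (hpos : ∀ (s : Finset ℝ) (c : ℝ → ℝ), 0 ≤ ∑ u ∈ s, ∑ v ∈ s, K (u, v) * (c u * c v))
    {f : ℝ → ℝ} (hf : MemLp f 2 (intervalMeasure a b)) :
    0 ≤ ∫ x in a..b, ∫ y in a..b, k x y * f x * f y := by
  have hfi : Integrable f (intervalMeasure a b) := hf.integrable (by norm_num)
  have h := integral_kernel_mul_nonneg (intervalMeasure a b) hpos hfi
  rw [integral_prod _ (integrable_kernel_mul K _ hfi hfi)] at h
  refine h.trans_eq ?_
  rw [intervalIntegral_eq_integral_intervalMeasure hab]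
  refine integral_congr_ae ?_
  filter_upwards [ae_restrict_mem measurableSet_Ioo] with x hx
  rw [intervalIntegral_eq_integral_intervalMeasure hab]
  refine integral_congr_ae ?_
  filter_upwards [ae_restrict_mem measurableSet_Ioo] with y hy
  rw [hkK x (Ioo_subset_Icc_self hx) y (Ioo_subset_Icc_self hy), mul_assoc]

end Restriction

theorem mainTheorem1 (a b : ℝ) (hab : a < b) (k : ℝ → ℝ → ℝ)
    (hcont : ContinuousOn (fun p : ℝ × ℝ => k p.1 p.2) (Icc a b ×ˢ Icc a b))
    (hker : IsMercerKernelOn k (Icc a b))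
    (hbdd : BddAbove ((fun p : ℝ × ℝ => k p.1 p.2) '' (Icc a b ×ˢ Icc a b))) :
    -- `T_k` is well defined on `L₂(a, b)`, with values in `L₂(a, b)`, and positive semi-definite
    (∀ f : ℝ → ℝ, MemLp f 2 (intervalMeasure a b) →
      (∀ x ∈ Icc a b, IntervalIntegrable (fun y => k x y * f y) volume a b) ∧
      MemLp (integralOperator a b k f) 2 (intervalMeasure a b) ∧
      0 ≤ ∫ x in a..b, ∫ y in a..b, k x y * f x * f y) ∧
    -- orthonormal basis of eigenfunctions `ψ i` with eigenvalues `ev i`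
    ∃ (e : HilbertBasis ℕ ℝ (L2Interval a b)) (ψ : ℕ → ℝ → ℝ) (ev : ℕ → ℝ),
      (∀ i, (e i : ℝ → ℝ) =ᵐ[intervalMeasure a b] ψ i) ∧
      (∀ i, 0 ≤ ev i) ∧
      (∀ i, ∀ x ∈ Icc a b, integralOperator a b k (ψ i) x = ev i * ψ i x) ∧
      (∀ i, ev i ≠ 0 → ContinuousOn (ψ i) (Icc a b)) ∧
      -- the expansion of `k` converges absolutely, and uniformly on `[a, b] × [a, b]`
      (∀ x ∈ Icc a b, ∀ y ∈ Icc a b, Summable fun i => |ev i * ψ i x * ψ i y|) ∧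
      TendstoUniformlyOn
        (fun (n : ℕ) (p : ℝ × ℝ) => ∑ i ∈ Finset.range n, ev i * ψ i p.1 * ψ i p.2)
        (fun p : ℝ × ℝ => k p.1 p.2) atTop (Icc a b ×ˢ Icc a b) := by
  obtain ⟨K, r, hr, hrx, hKr⟩ := exists_boundedContinuous_extension_kernel hab.le hcont
  have hkK : ∀ x ∈ Icc a b, ∀ y ∈ Icc a b, K (x, y) = k x y := fun x hx y hy => by
    rw [hKr, hrx x hx, hrx y hy]
  have hsymm : ∀ x y, K (x, y) = K (y, x) := fun x y => by
    rw [hKr, hKr, hker.symm _ (hr x) _ (hr y)]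
  have hpos : ∀ (s : Finset ℝ) (c : ℝ → ℝ),
      0 ≤ ∑ u ∈ s, ∑ v ∈ s, K (u, v) * (c u * c v) := fun s c => by
    simp only [hKr]
    exact hker.sum_nonneg r hr s c
  refine ⟨fun f hf => ⟨fun x hx => intervalIntegrable_kernel_mul hab.le hkK hf hx,
    memLp_integralOperator hab.le hkK hf,
    intervalIntegral_kernel_mul_nonneg hab.le hkK hpos hf⟩, ?_⟩
  -- Needed by the instance giving separability of `L₂`.
  have : Fact ((2 : ENNReal) ≠ ⊤) := ⟨by norm_num⟩
  obtain ⟨e, ev, he⟩ := ContinuousLinearMap.exists_hilbertBasis_eigenvectors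
    (L2Interval_not_finiteDimensional hab)
    (isCompactOperator_kernelOperator K (intervalMeasure a b) isCompact_Icc
      ((ae_restrict_mem measurableSet_Ioo).mono fun x hx => Ioo_subset_Icc_self hx))
    (kernelOperator_isSymmetric (intervalMeasure a b) hsymm)
  have hev := eigenvalue_nonneg hpos he
  let g := scaledEigenfunction K e ev
  -- For eigenvalue `0` any representative of `e i` will do: its terms in the series vanish.
  let ψ : ℕ → ℝ → ℝ := fun i => if ev i = 0 then e i else fun x => g i x / √(ev i)
  have hψ0 : ∀ i, ev i = 0 → ψ i = e i := fun i hi => if_pos hi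
  have hψ : ∀ i, ev i ≠ 0 → ψ i = fun x => g i x / √(ev i) := fun i hi => if_neg hi
  have hsqrt : ∀ i, ev i ≠ 0 → √(ev i) ≠ 0 := fun i hi => by
    rwa [Real.sqrt_ne_zero (hev i)]
  have heψ : ∀ i, (e i : ℝ → ℝ) =ᵐ[intervalMeasure a b] ψ i := by
    intro i
    by_cases hi : ev i = 0
    · rw [hψ0 i hi]
    · rw [hψ i hi]
      filter_upwards [scaledEigenfunction_ae_eq he i] with x hx
      simp only [g]
      rw [hx, mul_div_cancel_left₀ _ (hsqrt i hi)]
  -- This holds on all of `ℝ`: when `ev i = 0`, division by `√0 = 0` makes `g i` vanish.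
  have hprod : ∀ i x y, ev i * ψ i x * ψ i y = g i x * g i y := by
    intro i x y
    by_cases hi : ev i = 0
    · simp [hi, g, scaledEigenfunction]
    · simp only [hψ i hi]
      have h1 := hsqrt i hi
      have h2 := Real.mul_self_sqrt (hev i)
      field_simp
      linear_combination (-g i x * g i y) * h2
  refine ⟨e, ψ, ev, heψ, hev, fun i x hx => ?_, fun i hi => ?_, fun x hx y hy => ?_, ?_⟩
  · rw [integralOperator_eq_inner hab.le hkK (heψ i) hx]
    by_cases hi : ev i = 0
    · rw [inner_kernelFeature_eq_zero hab he hi hx, hi, zero_mul]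
    · rw [hψ i hi, ← sqrt_mul_scaledEigenfunction hab hpos he i hx]
      have h1 := hsqrt i hi
      have h2 := Real.mul_self_sqrt (hev i)
      field_simp
      linear_combination g i x * h2
  · rw [hψ i hi]
    exact ((continuous_scaledEigenfunction i).div_const _).continuousOn
  · simp only [hprod]
    exact summable_abs_mul_of_sq (summable_scaledEigenfunction_sq hab hsymm hpos he hx)
      (summable_scaledEigenfunction_sq hab hsymm hpos he hy)
  · simp only [hprod]
    exact (tendstoUniformlyOn_scaledEigenfunction_mul hab hsymm hpos he).congr_right
      fun p hp => hkK p.1 hp.1 p.2 hp.2
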